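/- All Banach spaces are real, and $B_X$ is the closed unit ball of $X$. For every limit ordinal $\alpha<\omega_1$ fix an enumeration $(\beta_n)_{n\in\omega}$ of all ordinals less than $\alpha$. *Trees.* Let $T_0=\{\varnothing\}$, $T_{\alpha+1}=\{\varnothing\}\cup 0^\smallfrown T_\alpha\cup 1^\smallfrown T_\alpha$, and $T_\alpha=\{\varnothing\}\cup\bigcup_n n^\smallfrown T_{\beta_n}$ for limit $\alpha<\omega_1$. For $\delta>0$, a $\delta$-$\alpha$-tree in $X$ is a family $(x_s)_{s\in T_\alpha}$ such that, whenever $s$ has exactly the two successors $s^\smallfrown 0,s^\smallfrown 1$ in $T_\alpha$, $x_s=\frac12(x_{s^\smallfrown 0}+x_{s^\smallfrown 1})$ and $\|x_{s^\smallfrown 0}-x_s\|=\|x_{s^\smallfrown 1}-x_s\|=\frac12\|x_{s^\smallfrown 0}-x_{s^\smallfrown 1}\|\ge\delta$, and, whenever $s$ has infinitely many successors $s^\smallfrown n$, $x_{s^\smallfrown n}=x_s$ for all $n$. Let $DT(X,\delta)$ be the least $\alpha<\omega_1$ such that $B_X$ contains no $\delta$-$\alpha$-tree, and $\infty$ if there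 is none ($\infty$ being larger than every ordinal), and $DT(X)=\sup_{\delta>0}DT(X,\delta)$. $X$ has the Infinite Tree Property if there are $\delta>0$ and $f:\{0,1\}^{<\omega}\to B_X$ with $f(s)=\frac12(f(s^\smallfrown 0)+f(s^\smallfrown 1))$ and $\frac12\|f(s^\smallfrown 0)-f(s^\smallfrown 1)\|\ge\delta$ for all $s$. *Diamonds.* $D_0^2$ is a single edge $\{t,b\}$ of weight $1$, with top $t$ and bottom $b$. $D_{\alpha+1}^2$ is obtained from the four-cycle $D_1^2$ with vertices $t,x^0,b,x^1$ and edges $\{t,x^i\},\{x^i,b\}$ ($i=0,1$) by replacing each edge by a copy of $D_\alpha^2$ with weights halved, its top at the upper end and its bottom at the lower end of the edge. For limit $\alpha$, $D_\alpha^2$ is the disjoint union of the $D_{\beta_n}^2$ with all tops identified and all bottoms identified. $d_\alpha$ is the shortest path metric. The active pairs are: in $D_0^2$, only $\{t,b\}$; in $D_{\alpha+1}^2$, all pairs of distinct points of $\{t,b,x^0,x^1\}$ and the active pairs of the four copies of $D_\alpha^2$; for limit $\alpha$, the active pairs of the $D_{\beta_n}^2$. $D_\alpha^2$ sub-Lipschitz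 embeds into $X$ if there are $A,B>0$ and $f:D_\alpha^2\to X$ with $A\,d_\alpha(u,v)\le\|f(u)-f(v)\|\le B\,d_\alpha(u,v)$ for all active pairs $\{u,v\}$. **Theorem.** Let $X$ be a separable Banach space, $\alpha$ an ordinal with $0<\alpha<\omega_1$, and $Y$ a Banach space that bi-Lipschitz embeds into $X$. Then: (1) $DT(X)>\alpha$ if and only if $D_\alpha^2$ sub-Lipschitz embeds into $X$. (2) $DT(Y)\le DT(X)$. (3) If $X$ fails the Infinite Tree Property, so does $Y$. -/

import Mathlib

open scoped Ordinal

/-! ### Enumerations at countable limit ordinals -/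

/-- A choice, for every countable limit ordinal `α`, of an enumeration `(βₙ)` of all the ordinals
less than `α`. The values of `seq` elsewhere are irrelevant. -/
structure LimitEnumeration where
  seq : Ordinal.{0} → ℕ → Ordinal.{0}
  range_seq : ∀ α : Ordinal.{0}, α < ω₁ → Order.IsSuccLimit α →
    Set.range (seq α) = Set.Iio α

/-- Such choices exist. -/
instance LimitEnumeration.instNonempty : Nonempty LimitEnumeration := by
  have h : ∀ α : Ordinal.{0}, ∃ s : ℕ → Ordinal.{0},
      α < ω₁ → Order.IsSuccLimit α → Set.range s = Set.Iio α := by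
    intro α
    by_cases hα : α < ω₁ ∧ Order.IsSuccLimit α
    · have hc : (Set.Iio α).Countable := by
        rw [← Cardinal.le_aleph0_iff_set_countable, Cardinal.mk_Iio_ordinal,
          Cardinal.lift_le_aleph0]
        have h1 := hα.1
        rwa [← Cardinal.ord_aleph, Cardinal.lt_ord, ← Cardinal.succ_aleph0,
          Order.lt_succ_iff] at h1
      have hne : (Set.Iio α).Nonempty := ⟨0, hα.2.bot_lt⟩
      obtain ⟨s, hs⟩ := hc.exists_eq_range hne
      exact ⟨s, fun _ _ => hs.symm⟩
    · exact ⟨fun _ => 0, fun h1 h2 => absurd ⟨h1, h2⟩ hα⟩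
  choose s hs using h
  exact ⟨⟨s, hs⟩⟩

/-! ### Dyadic trees and the dyadic tree index -/

/-- The nodes of the tree `T_α`, as finite sequences of natural numbers:
`T_0 = {∅}`, `T_{β+1} = {∅} ∪ 0⌢T_β ∪ 1⌢T_β`, and `T_α = {∅} ∪ ⋃ₙ n⌢T_{βₙ}` for `α` limit. -/
inductive IsDyadicNode (e : LimitEnumeration) : Ordinal.{0} → List ℕ → Prop
  | root (α : Ordinal.{0}) : IsDyadicNode e α []
  | succ_zero {β : Ordinal.{0}} {t : List ℕ} (ht : IsDyadicNode e β t) :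
      IsDyadicNode e (β + 1) (0 :: t)
  | succ_one {β : Ordinal.{0}} {t : List ℕ} (ht : IsDyadicNode e β t) :
      IsDyadicNode e (β + 1) (1 :: t)
  | limit {α : Ordinal.{0}} (hα : Order.IsSuccLimit α) (n : ℕ) {t : List ℕ}
      (ht : IsDyadicNode e (e.seq α n) t) : IsDyadicNode e α (n :: t)

/-- The tree `T_α`. -/
def dyadicTree (e : LimitEnumeration) (α : Ordinal.{0}) : Set (List ℕ) :=
  {s | IsDyadicNode e α s}

/-- `(x_s)_{s ∈ T_α}` is a `δ`-`α`-tree in `X`. -/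
structure IsDeltaTree {X : Type*} [NormedAddCommGroup X] [NormedSpace ℝ X]
    (e : LimitEnumeration) (δ : ℝ) (α : Ordinal.{0}) (x : dyadicTree e α → X) : Prop where
  /-- The condition at a node whose successors are exactly `s⌢0` and `s⌢1`. -/
  two_successors : ∀ (s : dyadicTree e α)
    (h₀ : (s : List ℕ) ++ [0] ∈ dyadicTree e α) (h₁ : (s : List ℕ) ++ [1] ∈ dyadicTree e α),
    {n : ℕ | (s : List ℕ) ++ [n] ∈ dyadicTree e α} = {0, 1} →
      x s = (1 / 2 : ℝ) • (x ⟨_, h₀⟩ + x ⟨_, h₁⟩) ∧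
      ‖x ⟨_, h₀⟩ - x s‖ = ‖x ⟨_, h₁⟩ - x s‖ ∧
      ‖x ⟨_, h₁⟩ - x s‖ = 1 / 2 * ‖x ⟨_, h₀⟩ - x ⟨_, h₁⟩‖ ∧
      δ ≤ 1 / 2 * ‖x ⟨_, h₀⟩ - x ⟨_, h₁⟩‖
  /-- The condition at a node with infinitely many successors. -/
  infinitely_many_successors : ∀ s : dyadicTree e α,
    {n : ℕ | (s : List ℕ) ++ [n] ∈ dyadicTree e α}.Infinite →
      ∀ (n : ℕ) (hn : (s : List ℕ) ++ [n] ∈ dyadicTree e α), x s = x ⟨_, hn⟩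

/-- The closed unit ball of `X` contains a `δ`-`α`-tree. -/
def UnitBallContainsDeltaTree (e : LimitEnumeration) (X : Type*) [NormedAddCommGroup X]
    [NormedSpace ℝ X] (δ : ℝ) (α : Ordinal.{0}) : Prop :=
  ∃ x : dyadicTree e α → X, (∀ s, x s ∈ Metric.closedBall (0 : X) 1) ∧ IsDeltaTree e δ α x

/-- `DT(X, δ)`, the least `α < ω₁` such that the unit ball contains no `δ`-`α`-tree, and
`∞ = ⊤` if there is no such `α`. -/
noncomputable def dyadicTreeIndexAt (e : LimitEnumeration) (X : Type*) [NormedAddCommGroup X]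
    [NormedSpace ℝ X] (δ : ℝ) : WithTop Ordinal.{0} :=
  ⨅ (α : Ordinal.{0}) (_ : α < ω₁) (_ : ¬ UnitBallContainsDeltaTree e X δ α),
    (α : WithTop Ordinal.{0})

/-- The dyadic tree index `DT(X) = sup {DT(X, δ) : δ > 0}`. -/
noncomputable def dyadicTreeIndex (e : LimitEnumeration) (X : Type*) [NormedAddCommGroup X]
    [NormedSpace ℝ X] : WithTop Ordinal.{0} :=
  ⨆ (δ : ℝ) (_ : 0 < δ), dyadicTreeIndexAt e X δ

/-- The Infinite Tree Property: for some `δ > 0`, there is a map `f` from the set of all finite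
sequences in `{0, 1}` to the unit ball, each value of which is the midpoint of the next two, and
these two are at distance at least `2 δ`. -/
def InfiniteTreeProperty (X : Type*) [NormedAddCommGroup X] [NormedSpace ℝ X] : Prop :=
  ∃ δ : ℝ, 0 < δ ∧ ∃ f : List (Fin 2) → X, (∀ s, f s ∈ Metric.closedBall (0 : X) 1) ∧
    ∀ s, f s = (1 / 2 : ℝ) • (f (s ++ [0]) + f (s ++ [1])) ∧
      δ ≤ 1 / 2 * ‖f (s ++ [0]) - f (s ++ [1])‖

/-! ### Dyadic diamond graphs of ordinal height -/

/-- Names for the vertices of diamonds other than the top and the bottom: `mid i` is the vertex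
`x^i` of the original `D_1` in `D_{β+1}`; `copy i s v` is the vertex `v` in the copy of `D_β` that
replaces the edge `(i, s)`, where `s = true` stands for `+` and `s = false` for `-`; and
`piece n v` is the vertex `v` of the `n`-th piece `D_{βₙ}` of `D_α`, for `α` limit. -/
inductive DiamondInner : Type
  | mid (i : Fin 2) : DiamondInner
  | copy (i : Fin 2) (s : Bool) (v : DiamondInner) : DiamondInner
  | piece (n : ℕ) (v : DiamondInner) : DiamondInner

/-- Names for the vertices of diamonds. -/
inductive DiamondVertex : Type
  | top : DiamondVertex
  | bot : DiamondVertex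
  | inner (v : DiamondInner) : DiamondVertex

namespace DiamondVertex

/-- The inclusion of `D_β` into `D_{β+1}` as the copy that replaces the edge `(i, +) = {t, x^i}`
(if `s = true`) or the edge `(i, -) = {x^i, b}` (if `s = false`): the top goes to the upper end
of that edge, and the bottom to its lower end. -/
def copyMap (i : Fin 2) : Bool → DiamondVertex → DiamondVertex
  | true, top => top
  | true, bot => inner (.mid i)
  | false, top => inner (.mid i)
  | false, bot => bot
  | s, inner v => inner (.copy i s v)

/-- The inclusion of the `n`-th piece `D_{βₙ}` into `D_α`, for `α` limit; tops are identified, and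
so are bottoms. -/
def pieceMap (n : ℕ) : DiamondVertex → DiamondVertex
  | top => top
  | bot => bot
  | inner v => inner (.piece n v)

end DiamondVertex

open DiamondVertex in
/-- The vertices of `D_α`: those of `D_0` are the top and the bottom; `D_{β+1}` is the union of
the four copies of `D_β`; and `D_α` is the union of its pieces, for `α` limit. -/
inductive IsDiamondVertex (e : LimitEnumeration) : Ordinal.{0} → DiamondVertex → Prop
  | zero_top : IsDiamondVertex e 0 top
  | zero_bot : IsDiamondVertex e 0 bot
  | copy {β : Ordinal.{0}} (i : Fin 2) (s : Bool) {v : DiamondVertex}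
      (hv : IsDiamondVertex e β v) : IsDiamondVertex e (β + 1) (copyMap i s v)
  | piece {α : Ordinal.{0}} (hα : Order.IsSuccLimit α) (n : ℕ) {v : DiamondVertex}
      (hv : IsDiamondVertex e (e.seq α n) v) : IsDiamondVertex e α (pieceMap n v)

/-- The vertex set of the dyadic diamond graph `D_α`. -/
def diamond (e : LimitEnumeration) (α : Ordinal.{0}) : Set DiamondVertex :=
  {v | IsDiamondVertex e α v}

open DiamondVertex in
/-- `IsDiamondEdge e α p w` says that `p` is an edge of weight `w` of the weighted graph `D_α`. The
only edge of `D_0` is `{t, b}`, of weight `1`; weights are halved in the copies of `D_β` in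
`D_{β+1}`, and kept in the pieces of `D_α` for `α` limit. -/
inductive IsDiamondEdge (e : LimitEnumeration) :
    Ordinal.{0} → Sym2 DiamondVertex → ℝ → Prop
  | zero : IsDiamondEdge e 0 s(top, bot) 1
  | copy {β : Ordinal.{0}} (i : Fin 2) (s : Bool) {p : Sym2 DiamondVertex} {w : ℝ}
      (hp : IsDiamondEdge e β p w) : IsDiamondEdge e (β + 1) (p.map (copyMap i s)) (w / 2)
  | piece {α : Ordinal.{0}} (hα : Order.IsSuccLimit α) (n : ℕ) {p : Sym2 DiamondVertex} {w : ℝ}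
      (hp : IsDiamondEdge e (e.seq α n) p w) : IsDiamondEdge e α (p.map (pieceMap n)) w

/-- `IsDiamondWalk e α u v ℓ` says that `D_α` has a finite walk of total weight `ℓ` from `u`
to `v`. -/
inductive IsDiamondWalk (e : LimitEnumeration) (α : Ordinal.{0}) :
    DiamondVertex → DiamondVertex → ℝ → Prop
  | nil (u : DiamondVertex) : IsDiamondWalk e α u u 0
  | cons {u v z : DiamondVertex} {w ℓ : ℝ} (huv : IsDiamondEdge e α s(u, v) w)
      (hvz : IsDiamondWalk e α v z ℓ) : IsDiamondWalk e α u z (w + ℓ)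

/-- The shortest path metric `d_α` of the weighted graph `D_α`. -/
noncomputable def diamondDist (e : LimitEnumeration) (α : Ordinal.{0})
    (u v : diamond e α) : ℝ :=
  sInf {ℓ : ℝ | IsDiamondWalk e α u v ℓ}

open DiamondVertex in
/-- The active pairs of `D_α`: for `α = 0`, only `{t, b}`; for `α = β + 1`, all pairs of distinct
vertices of the original `D_1 = {t, b, x^0, x^1}` and the active pairs of the copies of `D_β`; for
`α` limit, the active pairs of the pieces. -/
inductive IsActivePair (e : LimitEnumeration) : Ordinal.{0} → Sym2 DiamondVertex → Prop
  | zero : IsActivePair e 0 s(top, bot)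
  | original {β : Ordinal.{0}} {u v : DiamondVertex}
      (hu : u ∈ ({top, bot, inner (.mid 0), inner (.mid 1)} : Set DiamondVertex))
      (hv : v ∈ ({top, bot, inner (.mid 0), inner (.mid 1)} : Set DiamondVertex))
      (huv : u ≠ v) : IsActivePair e (β + 1) s(u, v)
  | copy {β : Ordinal.{0}} (i : Fin 2) (s : Bool) {p : Sym2 DiamondVertex}
      (hp : IsActivePair e β p) : IsActivePair e (β + 1) (p.map (copyMap i s))
  | piece {α : Ordinal.{0}} (hα : Order.IsSuccLimit α) (n : ℕ) {p : Sym2 DiamondVertex}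
      (hp : IsActivePair e (e.seq α n) p) : IsActivePair e α (p.map (pieceMap n))

/-- `D_α` sub-Lipschitz embeds into `X`: some map is bi-Lipschitz on the active pairs. -/
def DiamondSubLipschitzEmbeds (e : LimitEnumeration) (α : Ordinal.{0}) (X : Type*)
    [NormedAddCommGroup X] : Prop :=
  ∃ (A B : ℝ) (f : diamond e α → X), 0 < A ∧ 0 < B ∧
    ∀ u v : diamond e α, IsActivePair e α s((u : DiamondVertex), (v : DiamondVertex)) →
      A * diamondDist e α u v ≤ ‖f u - f v‖ ∧ ‖f u - f v‖ ≤ B * diamondDist e α u v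

/-- `M` bi-Lipschitz embeds into `N`. -/
def BiLipschitzEmbeds (M N : Type*) [PseudoEMetricSpace M] [PseudoEMetricSpace N] : Prop :=
  ∃ f : M → N, (∃ K, LipschitzWith K f) ∧ ∃ K, AntilipschitzWith K f

/-! ### Induction on countable ordinals -/

/-! Trees and diamonds carry the same data: a tree value is the increment of a diamond map along an
edge, divided by the scale of that edge.

From a tree to a diamond (`HasTree.exists_isSubLipschitz`): translate the tree by a vector of norm
`2`, so that all its values have norm between `1` and `3`. If the root `x` is the mean of `x₀` and
`x₁`, put the top at `x`, the bottom at `0` and the midpoints at `x₀/2` and `x₁/2`. Every edge then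
has half of `x₀` or of `x₁` as increment and is filled recursively, while the distance of the
midpoints is the separation in the tree.

From a diamond to a tree (`IsSubLipschitz.hasTree`): take the increment from bottom to top as root
and twice the increments through one midpoint `m` as children. Their half-distance is `‖t + b -
2m‖`, and by the triangle inequality one of the two midpoints makes this at least the distance
between them (`le_norm_add_sub_two_smul`).

This gives (1). Sub-Lipschitz embeddings compose with bi-Lipschitz maps, so (2) follows by applying
(1) at the height `DT(X)`, which is countable unless infinite (`exists_dyadicTreeIndex_le`). For (3)
the same choice of midpoints is iterated along an infinite tree.

The bookkeeping consists of replacing families indexed by nodes by the predicate `HasTree` on roots,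
and of computing the distances of active pairs (`ActiveScale.diamondDist_eq`). -/

theorem LimitEnumeration.seq_lt (e : LimitEnumeration) {α : Ordinal.{0}} (hα : α < ω₁)
    (hl : Order.IsSuccLimit α) (n : ℕ) : e.seq α n < α := by
  have h : e.seq α n ∈ Set.range (e.seq α) := ⟨n, rfl⟩
  rwa [e.range_seq α hα hl] at h

theorem LimitEnumeration.exists_seq_eq (e : LimitEnumeration) {α β : Ordinal.{0}} (hα : α < ω₁)
    (hl : Order.IsSuccLimit α) (hβ : β < α) : ∃ n, e.seq α n = β := by
  have h : β ∈ Set.range (e.seq α) := by rw [e.range_seq α hα hl]; exact hβ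
  exact h

theorem not_isSuccLimit_add_one (β : Ordinal.{0}) : ¬ Order.IsSuccLimit (β + 1) := by
  rw [← Order.succ_eq_add_one]
  exact Order.not_isSuccLimit_succ β

theorem not_isSuccLimit_zero : ¬ Order.IsSuccLimit (0 : Ordinal.{0}) :=
  fun h => h.bot_lt.ne rfl

theorem add_one_ne_zero_ordinal (β : Ordinal.{0}) : β + 1 ≠ 0 := by
  rw [← Order.succ_eq_add_one]
  exact Order.succ_ne_bot β

/-- Countability is needed because the enumeration is unconstrained at limits from `ω₁` on, where
its terms need not be smaller. -/
theorem countable_ordinal_induction (e : LimitEnumeration) {P : Ordinal.{0} → Prop} (zero : P 0)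
    (succ : ∀ β, P β → P (β + 1))
    (limit : ∀ α, α < ω₁ → Order.IsSuccLimit α → (∀ n, P (e.seq α n)) → P α)
    (α : Ordinal.{0}) (hα : α < ω₁) : P α := by
  induction α using Ordinal.limitRecOn with
  | zero => exact zero
  | add_one β ih =>
    exact succ β (ih (lt_of_le_of_lt (le_self_add) hα))
  | limit α hl ih =>
    exact limit α hα hl fun n => ih _ (e.seq_lt hα hl n) ((e.seq_lt hα hl n).trans hα)

/-! ### Trees described by their roots -/

section Tree

variable {X : Type*} [NormedAddCommGroup X] [NormedSpace ℝ X]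

/-- `HasTree e C δ α x` says that there is a `δ`-`α`-tree with values in `C` and root `x`. -/
inductive HasTree (e : LimitEnumeration) (C : Set X) (δ : ℝ) : Ordinal.{0} → X → Prop
  | zero {x : X} (hx : x ∈ C) : HasTree e C δ 0 x
  | succ {β : Ordinal.{0}} {x x₀ x₁ : X} (hx : x ∈ C) (h : x = (1 / 2 : ℝ) • (x₀ + x₁))
      (hδ : δ ≤ 1 / 2 * ‖x₀ - x₁‖) (h₀ : HasTree e C δ β x₀) (h₁ : HasTree e C δ β x₁) :
      HasTree e C δ (β + 1) x
  | limit {α : Ordinal.{0}} {x : X} (hα : Order.IsSuccLimit α)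
      (h : ∀ n, HasTree e C δ (e.seq α n) x) : HasTree e C δ α x

variable {e : LimitEnumeration} {C : Set X} {δ : ℝ} {α : Ordinal.{0}} {x : X}

theorem HasTree.mem (h : HasTree e C δ α x) : x ∈ C := by
  induction h with
  | zero hx => exact hx
  | succ hx => exact hx
  | limit _ _ ih => exact ih 0

/-- Affine maps preserve midpoints. The cases used are translation away from the origin and
rescaling into the unit ball. -/
theorem HasTree.map {C' : Set X} {c : ℝ} (hc : 0 ≤ c) (z : X)
    (hC : ∀ y ∈ C, c • y + z ∈ C') (h : HasTree e C δ α x) :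
    HasTree e C' (c * δ) α (c • x + z) := by
  induction h with
  | zero hx => exact .zero (hC _ hx)
  | @succ β x x₀ x₁ hx h hδ _ _ ih₀ ih₁ =>
    refine .succ (hC _ hx) ?_ ?_ ih₀ ih₁
    · rw [h]; module
    · rw [add_sub_add_right_eq_sub, ← smul_sub, norm_smul, Real.norm_of_nonneg hc]
      calc c * δ ≤ c * (1 / 2 * ‖x₀ - x₁‖) := by gcongr
        _ = _ := by ring
  | limit hα _ ih => exact .limit hα ih

theorem HasTree.mono_delta {δ' : ℝ} (hδ : δ' ≤ δ) (h : HasTree e C δ α x) :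
    HasTree e C δ' α x := by
  induction h with
  | zero hx => exact .zero hx
  | succ hx h hd _ _ ih₀ ih₁ => exact .succ hx h (hδ.trans hd) ih₀ ih₁
  | limit hα _ ih => exact .limit hα ih

/-- Subtrees supply the smaller heights: pass to a child at successors, and keep the root at limits,
where every smaller height is enumerated. Hence the least failing height is a threshold. -/
theorem HasTree.exists_of_le (hα : α < ω₁) (h : HasTree e C δ α x) {γ : Ordinal.{0}}
    (hγ : γ ≤ α) : ∃ y, HasTree e C δ γ y := by
  induction h with
  | zero hx =>
    obtain rfl : γ = 0 := le_antisymm hγ zero_le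
    exact ⟨_, .zero hx⟩
  | @succ β x x₀ x₁ hx h hd h₀ h₁ ih₀ _ =>
    rcases hγ.eq_or_lt with rfl | hlt
    · exact ⟨x, .succ hx h hd h₀ h₁⟩
    · exact ih₀ (lt_of_le_of_lt le_self_add hα) (Order.lt_add_one_iff.1 hlt)
  | @limit α x hl h ih =>
    rcases hγ.eq_or_lt with rfl | hlt
    · exact ⟨x, .limit hl h⟩
    · obtain ⟨n, hn⟩ := e.exists_seq_eq hα hl hlt
      exact ih n ((e.seq_lt hα hl n).trans hα) hn.ge

theorem HasTree.nontrivial (hδ : 0 < δ) (hα₀ : α ≠ 0) (hα : α < ω₁) (h : HasTree e C δ α x) :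
    Nontrivial X := by
  obtain ⟨y, hy⟩ := h.exists_of_le hα (γ := 0 + 1) (by
    rw [zero_add]; exact Order.one_le_iff_pos.2 (pos_iff_ne_zero.2 hα₀))
  generalize hγ : (0 : Ordinal.{0}) + 1 = γ at hy
  cases hy with
  | zero => exact absurd hγ (add_one_ne_zero_ordinal 0)
  | @succ _ _ x₀ x₁ _ _ hd _ _ =>
    refine ⟨x₀, x₁, fun h => ?_⟩
    rw [h, sub_self, norm_zero] at hd
    linarith
  | limit hl => exact absurd (hγ ▸ hl) (not_isSuccLimit_add_one 0)

/-! ### Nodes of the dyadic trees -/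

theorem not_isDyadicNode_zero_cons {n : ℕ} {t : List ℕ} : ¬ IsDyadicNode e 0 (n :: t) := by
  intro h
  generalize h0 : (0 : Ordinal.{0}) = γ at h
  cases h with
  | succ_zero => exact add_one_ne_zero_ordinal _ h0.symm
  | succ_one => exact add_one_ne_zero_ordinal _ h0.symm
  | limit hl => exact not_isSuccLimit_zero (h0 ▸ hl)

theorem isDyadicNode_succ_cons {β : Ordinal.{0}} {n : ℕ} {t : List ℕ} :
    IsDyadicNode e (β + 1) (n :: t) ↔ (n = 0 ∨ n = 1) ∧ IsDyadicNode e β t := by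
  constructor
  · intro h
    generalize h0 : β + 1 = γ at h
    cases h with
    | succ_zero ht => exact ⟨.inl rfl, by rwa [Order.add_one_inj.1 h0]⟩
    | succ_one ht => exact ⟨.inr rfl, by rwa [Order.add_one_inj.1 h0]⟩
    | limit hl => exact absurd (h0 ▸ hl) (not_isSuccLimit_add_one β)
  · rintro ⟨rfl | rfl, ht⟩
    · exact .succ_zero ht
    · exact .succ_one ht

theorem isDyadicNode_limit_cons (hα : Order.IsSuccLimit α) {n : ℕ} {t : List ℕ} :
    IsDyadicNode e α (n :: t) ↔ IsDyadicNode e (e.seq α n) t := by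
  constructor
  · intro h
    cases h with
    | succ_zero => exact absurd hα (not_isSuccLimit_add_one _)
    | succ_one => exact absurd hα (not_isSuccLimit_add_one _)
    | limit _ _ ht => exact ht
  · exact .limit hα n

/-- The conditions on a `δ`-`α`-tree, for a function defined on all finite sequences. -/
structure IsTotalTree (e : LimitEnumeration) (C : Set X) (δ : ℝ) (α : Ordinal.{0})
    (y : List ℕ → X) : Prop where
  mem : ∀ s, IsDyadicNode e α s → y s ∈ C
  two_successors : ∀ s, IsDyadicNode e α s →
    {n : ℕ | IsDyadicNode e α (s ++ [n])} = {0, 1} →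
      y s = (1 / 2 : ℝ) • (y (s ++ [0]) + y (s ++ [1])) ∧
      δ ≤ 1 / 2 * ‖y (s ++ [0]) - y (s ++ [1])‖
  infinitely_many_successors : ∀ s, IsDyadicNode e α s →
    {n : ℕ | IsDyadicNode e α (s ++ [n])}.Infinite →
      ∀ n : ℕ, IsDyadicNode e α (s ++ [n]) → y s = y (s ++ [n])

theorem isTotalTree_zero_iff {y : List ℕ → X} : IsTotalTree e C δ 0 y ↔ y [] ∈ C := by
  constructor
  · exact fun h => h.mem [] (.root 0)
  · intro h
    have hnil : ∀ s, IsDyadicNode e 0 s → s = [] := by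
      rintro (_ | ⟨n, t⟩) hs
      · rfl
      · exact absurd hs not_isDyadicNode_zero_cons
    refine ⟨fun s hs => hnil s hs ▸ h, fun s hs h2 => ?_, fun s hs _ n hn => ?_⟩
    · have : (0 : ℕ) ∈ ({0, 1} : Set ℕ) := by simp
      rw [← h2] at this
      exact absurd (hnil _ this) (by simp)
    · exact absurd (hnil _ hn) (by simp)

theorem isTotalTree_succ_iff {β : Ordinal.{0}} {y : List ℕ → X} :
    IsTotalTree e C δ (β + 1) y ↔
      y [] ∈ C ∧ y [] = (1 / 2 : ℝ) • (y [0] + y [1]) ∧ δ ≤ 1 / 2 * ‖y [0] - y [1]‖ ∧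
      ∀ i, i = 0 ∨ i = 1 → IsTotalTree e C δ β (fun t => y (i :: t)) := by
  have hset : ∀ i, i = 0 ∨ i = 1 → ∀ s, {n : ℕ | IsDyadicNode e (β + 1) (i :: s ++ [n])} =
      {n : ℕ | IsDyadicNode e β (s ++ [n])} := by
    intro i hi s
    ext n
    simp only [List.cons_append, Set.mem_ofPred_eq, isDyadicNode_succ_cons, hi, true_and]
  have hnil : {n : ℕ | IsDyadicNode e (β + 1) ([] ++ [n])} = {0, 1} := by
    ext n
    simp only [List.nil_append, Set.mem_ofPred_eq, isDyadicNode_succ_cons,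
      IsDyadicNode.root, and_true, Set.mem_insert_iff, Set.mem_singleton_iff]
  constructor
  · intro h
    obtain ⟨h1, h2⟩ := h.two_successors [] (.root _) hnil
    refine ⟨h.mem [] (.root _), h1, h2, fun i hi => ⟨fun s hs => ?_, fun s hs hs2 => ?_,
      fun s hs hs2 n hn => ?_⟩⟩
    · exact h.mem _ (isDyadicNode_succ_cons.2 ⟨hi, hs⟩)
    · exact h.two_successors (i :: s) (isDyadicNode_succ_cons.2 ⟨hi, hs⟩)
        ((hset i hi s).trans hs2)
    · exact h.infinitely_many_successors (i :: s) (isDyadicNode_succ_cons.2 ⟨hi, hs⟩)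
        ((hset i hi s).symm ▸ hs2) n (isDyadicNode_succ_cons.2 ⟨hi, hn⟩)
  · rintro ⟨h0, h1, h2, h⟩
    refine ⟨?_, ?_, ?_⟩
    · rintro (_ | ⟨i, s⟩) hs
      · exact h0
      · obtain ⟨hi, hs⟩ := isDyadicNode_succ_cons.1 hs
        exact (h i hi).mem s hs
    · rintro (_ | ⟨i, s⟩) hs hs2
      · exact ⟨h1, h2⟩
      · obtain ⟨hi, hs⟩ := isDyadicNode_succ_cons.1 hs
        exact (h i hi).two_successors s hs ((hset i hi s).symm.trans hs2)
    · rintro (_ | ⟨i, s⟩) hs hs2 n hn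
      · rw [hnil] at hs2
        exact absurd (Set.toFinite _) hs2
      · obtain ⟨hi, hs⟩ := isDyadicNode_succ_cons.1 hs
        exact (h i hi).infinitely_many_successors s hs (hset i hi s ▸ hs2) n
          (isDyadicNode_succ_cons.1 hn).2

theorem isTotalTree_limit_iff (hα : Order.IsSuccLimit α) {y : List ℕ → X} :
    IsTotalTree e C δ α y ↔
      y [] ∈ C ∧ (∀ n, y [n] = y []) ∧
      ∀ n, IsTotalTree e C δ (e.seq α n) (fun t => y (n :: t)) := by
  have hset : ∀ i s, {n : ℕ | IsDyadicNode e α (i :: s ++ [n])} =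
      {n : ℕ | IsDyadicNode e (e.seq α i) (s ++ [n])} := by
    intro i s
    ext n
    simp only [List.cons_append, Set.mem_ofPred_eq, isDyadicNode_limit_cons hα]
  have hnil : {n : ℕ | IsDyadicNode e α ([] ++ [n])} = Set.univ := by
    ext n
    simp only [List.nil_append, Set.mem_ofPred_eq, isDyadicNode_limit_cons hα,
      IsDyadicNode.root, Set.mem_univ]
  constructor
  · intro h
    refine ⟨h.mem [] (.root _), fun n => ?_, fun i => ⟨fun s hs => ?_, fun s hs hs2 => ?_,
      fun s hs hs2 n hn => ?_⟩⟩
    · exact (h.infinitely_many_successors [] (.root _) (hnil ▸ Set.infinite_univ) n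
        ((isDyadicNode_limit_cons hα).2 (.root _))).symm
    · exact h.mem _ ((isDyadicNode_limit_cons hα).2 hs)
    · exact h.two_successors (i :: s) ((isDyadicNode_limit_cons hα).2 hs)
        ((hset i s).trans hs2)
    · exact h.infinitely_many_successors (i :: s) ((isDyadicNode_limit_cons hα).2 hs)
        ((hset i s).symm ▸ hs2) n ((isDyadicNode_limit_cons hα).2 hn)
  · rintro ⟨h0, h1, h⟩
    refine ⟨?_, ?_, ?_⟩
    · rintro (_ | ⟨i, s⟩) hs
      · exact h0
      · exact (h i).mem s ((isDyadicNode_limit_cons hα).1 hs)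
    · rintro (_ | ⟨i, s⟩) hs hs2
      · rw [hnil] at hs2
        exact absurd (hs2 ▸ Set.toFinite ({0, 1} : Set ℕ)) Set.infinite_univ
      · exact (h i).two_successors s ((isDyadicNode_limit_cons hα).1 hs)
          ((hset i s).symm.trans hs2)
    · rintro (_ | ⟨i, s⟩) hs hs2 n hn
      · exact (h1 n).symm
      · exact (h i).infinitely_many_successors s ((isDyadicNode_limit_cons hα).1 hs)
          (hset i s ▸ hs2) n ((isDyadicNode_limit_cons hα).1 hn)

theorem IsTotalTree.hasTree (hα : α < ω₁) {y : List ℕ → X} (h : IsTotalTree e C δ α y) :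
    HasTree e C δ α (y []) := by
  revert y
  refine countable_ordinal_induction e (P := fun α => ∀ {y : List ℕ → X},
    IsTotalTree e C δ α y → HasTree e C δ α (y [])) ?_ ?_ ?_ α hα
  · exact fun h => .zero (isTotalTree_zero_iff.1 h)
  · intro β ih y h
    obtain ⟨h0, h1, h2, h3⟩ := isTotalTree_succ_iff.1 h
    exact .succ h0 h1 h2 (ih (h3 0 (.inl rfl))) (ih (h3 1 (.inr rfl)))
  · intro α _ hl ih y h
    obtain ⟨h0, h1, h2⟩ := (isTotalTree_limit_iff hl).1 h
    exact .limit hl fun n => h1 n ▸ ih n (h2 n)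

theorem HasTree.exists_isTotalTree (h : HasTree e C δ α x) :
    ∃ y : List ℕ → X, y [] = x ∧ IsTotalTree e C δ α y := by
  induction h with
  | @zero x hx => exact ⟨fun _ => x, rfl, isTotalTree_zero_iff.2 hx⟩
  | @succ β x x₀ x₁ hx h hd _ _ ih₀ ih₁ =>
    obtain ⟨y₀, rfl, h₀⟩ := ih₀
    obtain ⟨y₁, rfl, h₁⟩ := ih₁
    -- Sequences starting with a number above `1` are not nodes here, so the last case matters only
    -- for `1`.
    refine ⟨fun s => match s with
      | [] => x
      | 0 :: t => y₀ t
      | _ :: t => y₁ t, rfl, isTotalTree_succ_iff.2 ⟨hx, h, hd, ?_⟩⟩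
    rintro i (rfl | rfl)
    · exact h₀
    · exact h₁
  | @limit α x hl h ih =>
    choose y hy h' using ih
    refine ⟨fun s => match s with
      | [] => x
      | n :: t => y n t, rfl, (isTotalTree_limit_iff hl).2 ⟨(h 0).mem, hy, h'⟩⟩

-- The equalities of norms in the definition of a tree follow from the midpoint identity, and values
-- off the tree are irrelevant.
open Classical in
theorem unitBallContainsDeltaTree_iff (hα : α < ω₁) :
    UnitBallContainsDeltaTree e X δ α ↔
      ∃ x, HasTree e (Metric.closedBall (0 : X) 1) δ α x := by
  constructor
  · rintro ⟨x, hx, hT⟩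
    set y : List ℕ → X := fun s => if h : s ∈ dyadicTree e α then x ⟨s, h⟩ else 0 with hy
    have hyx : ∀ (s : List ℕ) (h : s ∈ dyadicTree e α), y s = x ⟨s, h⟩ := fun s h => by
      simp only [hy, dif_pos h]
    refine ⟨y [], IsTotalTree.hasTree hα ⟨fun s hs => ?_, fun s hs h2 => ?_,
      fun s hs h2 n hn => ?_⟩⟩
    · rw [hyx s hs]; exact hx _
    · have h₀ : (0 : ℕ) ∈ ({0, 1} : Set ℕ) := by simp
      have h₁ : (1 : ℕ) ∈ ({0, 1} : Set ℕ) := by simp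
      rw [← h2] at h₀ h₁
      rw [hyx s hs, hyx _ h₀, hyx _ h₁]
      obtain ⟨a, -, -, b⟩ := hT.two_successors ⟨s, hs⟩ h₀ h₁ h2
      exact ⟨a, b⟩
    · rw [hyx s hs, hyx _ hn]
      exact hT.infinitely_many_successors ⟨s, hs⟩ h2 n hn
  · rintro ⟨x, hx⟩
    obtain ⟨y, -, hy⟩ := hx.exists_isTotalTree
    refine ⟨fun s => y s, fun s => hy.mem s s.2, ⟨fun ⟨s, hs⟩ h₀ h₁ h2 => ?_, fun s h2 n hn => ?_⟩⟩
    · obtain ⟨h, hδ⟩ := hy.two_successors s hs h2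
      have e₀ : y (s ++ [0]) - y s = (1 / 2 : ℝ) • (y (s ++ [0]) - y (s ++ [1])) := by
        rw [h]; module
      have e₁ : y (s ++ [1]) - y s = -((1 / 2 : ℝ) • (y (s ++ [0]) - y (s ++ [1]))) := by
        rw [h]; module
      have e₂ : ‖y (s ++ [1]) - y s‖ = 1 / 2 * ‖y (s ++ [0]) - y (s ++ [1])‖ := by
        rw [e₁, norm_neg, norm_smul]; norm_num
      refine ⟨h, ?_, e₂, hδ⟩
      change ‖y (s ++ [0]) - y s‖ = ‖y (s ++ [1]) - y s‖
      rw [e₀, e₁, norm_neg]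
    · exact hy.infinitely_many_successors s s.2 h2 n hn

end Tree

/-! ### The dyadic tree index -/

section Index

variable {e : LimitEnumeration} {X : Type*} [NormedAddCommGroup X] [NormedSpace ℝ X] {δ : ℝ}
  {α : Ordinal.{0}}

theorem lt_dyadicTreeIndexAt_iff (hα : α < ω₁) :
    (α : WithTop Ordinal.{0}) < dyadicTreeIndexAt e X δ ↔
      ∃ x, HasTree e (Metric.closedBall (0 : X) 1) δ α x := by
  constructor
  · intro h
    by_contra hn
    rw [← unitBallContainsDeltaTree_iff hα] at hn
    exact absurd h (not_lt.2 (iInf_le_of_le α (iInf_le_of_le hα (iInf_le _ hn))))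
  · rintro ⟨x, hx⟩
    -- Every failing height exceeds `α`, so the infimum is at least `α + 1`; this makes the
    -- inequality strict even if the infimum is over an empty set.
    refine lt_of_lt_of_le (WithTop.coe_lt_coe.2 (Order.lt_add_one_iff.2 le_rfl)) <|
      le_iInf fun γ => le_iInf fun hγ => le_iInf fun hn => WithTop.coe_le_coe.2 ?_
    rw [unitBallContainsDeltaTree_iff hγ] at hn
    rw [Order.add_one_le_iff]
    by_contra hle
    exact hn (hx.exists_of_le hα (not_lt.1 hle))

theorem lt_dyadicTreeIndex_iff (hα : α < ω₁) :
    (α : WithTop Ordinal.{0}) < dyadicTreeIndex e X ↔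
      ∃ δ > 0, ∃ x, HasTree e (Metric.closedBall (0 : X) 1) δ α x := by
  simp only [dyadicTreeIndex, lt_iSup_iff, lt_dyadicTreeIndexAt_iff hα, exists_prop, gt_iff_lt]

/-- Needed to exclude height `0`, where the correspondence with diamonds can fail. -/
theorem dyadicTreeIndex_pos : (0 : Ordinal.{0}) < dyadicTreeIndex e X :=
  (lt_dyadicTreeIndex_iff (Ordinal.omega_pos 1)).2 ⟨1, one_pos, 0, .zero (by simp)⟩

theorem dyadicTreeIndexAt_antitone {δ' : ℝ} (h : δ ≤ δ') :
    dyadicTreeIndexAt e X δ' ≤ dyadicTreeIndexAt e X δ := by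
  refine le_iInf fun γ => le_iInf fun hγ => le_iInf fun hn =>
    iInf_le_of_le γ (iInf_le_of_le hγ (iInf_le_of_le (fun h' => hn ?_) le_rfl))
  rw [unitBallContainsDeltaTree_iff hγ] at h' ⊢
  exact h'.imp fun x hx => hx.mono_delta h

theorem exists_dyadicTreeIndexAt_le (h : dyadicTreeIndexAt e X δ ≠ ⊤) :
    ∃ γ : Ordinal.{0}, γ < ω₁ ∧ dyadicTreeIndexAt e X δ ≤ γ := by
  by_contra! hn
  refine h (iInf_eq_top.2 fun γ => iInf_eq_top.2 fun hγ => iInf_eq_top.2 fun hc => ?_)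
  exact absurd (hn γ hγ) (not_lt.2 (iInf_le_of_le γ (iInf_le_of_le hγ (iInf_le _ hc))))

/-- The dyadic tree index is a countable ordinal or `∞`. -/
theorem exists_dyadicTreeIndex_le (h : dyadicTreeIndex e X ≠ ⊤) :
    ∃ γ : Ordinal.{0}, γ < ω₁ ∧ dyadicTreeIndex e X ≤ γ := by
  have hle : ∀ δ > 0, dyadicTreeIndexAt e X δ ≤ dyadicTreeIndex e X := fun δ hδ =>
    le_iSup₂_of_le δ hδ le_rfl
  -- By monotonicity in `δ`, the values `δ = 1/(n+1)` suffice, and a countable supremum of countable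
  -- ordinals is countable.
  have hn : ∀ n : ℕ, ∃ γ : Ordinal.{0}, γ < ω₁ ∧
      dyadicTreeIndexAt e X (1 / ((n : ℝ) + 1)) ≤ γ := fun n =>
    exists_dyadicTreeIndexAt_le fun ht => h (top_le_iff.1 (ht ▸ hle _ Nat.one_div_pos_of_nat))
  choose γ hγ hγ' using hn
  refine ⟨⨆ n, γ n, ?_, iSup₂_le fun δ hδ => ?_⟩
  · exact Ordinal.iSup_lt_omega_one hγ
  · obtain ⟨n, hn⟩ := exists_nat_one_div_lt hδ
    refine (dyadicTreeIndexAt_antitone hn.le).trans ((hγ' n).trans (WithTop.coe_le_coe.2 ?_))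
    exact Ordinal.le_iSup γ n

end Index

/-! ### Distances in diamonds -/

section Diamond

open DiamondVertex

variable {e : LimitEnumeration} {α β : Ordinal.{0}}

/-- `ActiveScale e α u v r` says that `{u, v}` is one of the active pairs that generate those of
`D_α`, and that its points are at distance `r`. -/
inductive ActiveScale (e : LimitEnumeration) :
    Ordinal.{0} → DiamondVertex → DiamondVertex → ℝ → Prop
  | zero : ActiveScale e 0 top bot 1
  | top_bot (β : Ordinal.{0}) : ActiveScale e (β + 1) top bot 1
  | mids (β : Ordinal.{0}) : ActiveScale e (β + 1) (inner (.mid 0)) (inner (.mid 1)) 1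
  | copy {β : Ordinal.{0}} (i : Fin 2) (s : Bool) {u v : DiamondVertex} {r : ℝ}
      (h : ActiveScale e β u v r) : ActiveScale e (β + 1) (copyMap i s u) (copyMap i s v) (r / 2)
  | piece {α : Ordinal.{0}} (hα : Order.IsSuccLimit α) (n : ℕ) {u v : DiamondVertex} {r : ℝ}
      (h : ActiveScale e (e.seq α n) u v r) : ActiveScale e α (pieceMap n u) (pieceMap n v) r

theorem activeScale_top_bot (hα : α < ω₁) : ActiveScale e α top bot 1 :=
  countable_ordinal_induction e (P := fun α => ActiveScale e α top bot 1) .zero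
    (fun β _ => .top_bot β) (fun _ _ hl ih => .piece hl 0 (ih 0)) α hα

theorem ActiveScale.isActivePair {u v : DiamondVertex} {r : ℝ} (h : ActiveScale e α u v r) :
    IsActivePair e α s(u, v) := by
  induction h with
  | zero => exact .zero
  | top_bot => exact .original (by simp) (by simp) (by simp)
  | mids => exact .original (by simp) (by simp) (by simp)
  | copy i s _ ih => exact .copy i s ih
  | piece hl n _ ih => exact .piece hl n ih

theorem top_bot_mem_diamond (hα : α < ω₁) : IsDiamondVertex e α top ∧ IsDiamondVertex e α bot := by
  refine countable_ordinal_induction e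
    (P := fun α => IsDiamondVertex e α top ∧ IsDiamondVertex e α bot) ?_ ?_ ?_ α hα
  · exact ⟨.zero_top, .zero_bot⟩
  · exact fun β h => ⟨.copy 0 true h.1, .copy 0 false h.2⟩
  · exact fun α _ hl h => ⟨.piece hl 0 (h 0).1, .piece hl 0 (h 0).2⟩

theorem ActiveScale.mem_diamond (hα : α < ω₁) {u v : DiamondVertex} {r : ℝ}
    (h : ActiveScale e α u v r) : IsDiamondVertex e α u ∧ IsDiamondVertex e α v := by
  induction h with
  | zero => exact top_bot_mem_diamond hα
  | top_bot => exact top_bot_mem_diamond hα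
  | mids β =>
    have hb := (top_bot_mem_diamond (e := e) (lt_of_le_of_lt le_self_add hα : β < ω₁)).2
    exact ⟨.copy 0 true hb, .copy 1 true hb⟩
  | copy i s _ ih =>
    have := ih (lt_of_le_of_lt le_self_add hα)
    exact ⟨.copy i s this.1, .copy i s this.2⟩
  | piece hl n _ ih =>
    have := ih ((e.seq_lt hα hl n).trans hα)
    exact ⟨.piece hl n this.1, .piece hl n this.2⟩

/-- Of the six pairs in the four-cycle, the two diagonals have their own constructors; the four
sides are the top-bottom pairs of the copies. -/
theorem IsActivePair.exists_activeScale (hα : α < ω₁) {p : Sym2 DiamondVertex}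
    (h : IsActivePair e α p) : ∃ u v r, p = s(u, v) ∧ ActiveScale e α u v r := by
  induction h with
  | zero => exact ⟨_, _, _, rfl, .zero⟩
  | @original β u v hu hv huv =>
    have hβ : β < ω₁ := lt_of_le_of_lt le_self_add hα
    have hc : ∀ i s, ActiveScale e (β + 1) (copyMap i s top) (copyMap i s bot) (1 / 2) :=
      fun i s => (activeScale_top_bot hβ).copy i s
    have h1 := ActiveScale.top_bot (e := e) β
    have h2 := ActiveScale.mids (e := e) β
    have key : ∀ {u v : DiamondVertex} {r : ℝ}, ActiveScale e (β + 1) u v r →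
        (∃ u' v' r, s(u, v) = s(u', v') ∧ ActiveScale e (β + 1) u' v' r) ∧
        (∃ u' v' r, s(v, u) = s(u', v') ∧ ActiveScale e (β + 1) u' v' r) := fun h =>
      ⟨⟨_, _, _, rfl, h⟩, ⟨_, _, _, Sym2.eq_swap, h⟩⟩
    rcases hu with rfl | rfl | rfl | rfl <;> rcases hv with rfl | rfl | rfl | rfl <;>
      first
      | exact absurd rfl huv
      | exact (key h1).1
      | exact (key h1).2
      | exact (key h2).1
      | exact (key h2).2
      | exact (key (hc 0 true)).1
      | exact (key (hc 0 true)).2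
      | exact (key (hc 0 false)).1
      | exact (key (hc 0 false)).2
      | exact (key (hc 1 true)).1
      | exact (key (hc 1 true)).2
      | exact (key (hc 1 false)).1
      | exact (key (hc 1 false)).2
  | copy i s _ ih =>
    obtain ⟨u, v, r, rfl, h⟩ := ih (lt_of_le_of_lt le_self_add hα)
    exact ⟨_, _, _, rfl, h.copy i s⟩
  | piece hl n _ ih =>
    obtain ⟨u, v, r, rfl, h⟩ := ih ((e.seq_lt hα hl n).trans hα)
    exact ⟨_, _, _, rfl, h.piece hl n⟩

/-! ### Walks -/

theorem IsDiamondWalk.trans {u v z : DiamondVertex} {ℓ ℓ' : ℝ} (h : IsDiamondWalk e α u v ℓ)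
    (h' : IsDiamondWalk e α v z ℓ') : IsDiamondWalk e α u z (ℓ + ℓ') := by
  induction h with
  | nil => rwa [zero_add]
  | cons huv _ ih => rw [add_assoc]; exact .cons huv (ih h')

theorem IsDiamondWalk.symm {u v : DiamondVertex} {ℓ : ℝ} (h : IsDiamondWalk e α u v ℓ) :
    IsDiamondWalk e α v u ℓ := by
  induction h with
  | nil => exact .nil _
  | @cons u v z w ℓ huv _ ih =>
    have := ih.trans (.cons (Sym2.eq_swap ▸ huv) (.nil u))
    rwa [add_zero, add_comm] at this

theorem IsDiamondWalk.copy (i : Fin 2) (s : Bool) {u v : DiamondVertex} {ℓ : ℝ}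
    (h : IsDiamondWalk e β u v ℓ) :
    IsDiamondWalk e (β + 1) (copyMap i s u) (copyMap i s v) (ℓ / 2) := by
  induction h with
  | nil => rw [zero_div]; exact .nil _
  | cons huv _ ih => rw [add_div]; exact .cons (huv.copy i s) ih

theorem IsDiamondWalk.piece (hα : Order.IsSuccLimit α) (n : ℕ) {u v : DiamondVertex} {ℓ : ℝ}
    (h : IsDiamondWalk e (e.seq α n) u v ℓ) :
    IsDiamondWalk e α (pieceMap n u) (pieceMap n v) ℓ := by
  induction h with
  | nil => exact .nil _
  | cons huv _ ih => exact .cons (huv.piece hα n) ih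

theorem isDiamondWalk_top_bot (hα : α < ω₁) : IsDiamondWalk e α top bot 1 := by
  refine countable_ordinal_induction e (P := fun α => IsDiamondWalk e α top bot 1) ?_ ?_ ?_ α hα
  · simpa using IsDiamondWalk.cons (e := e) .zero (.nil bot)
  · intro β h
    have := (h.copy 0 true).trans (h.copy 0 false)
    rwa [add_halves] at this
  · exact fun α _ hl h => (h 0).piece hl 0

theorem ActiveScale.isDiamondWalk (hα : α < ω₁) {u v : DiamondVertex} {r : ℝ}
    (h : ActiveScale e α u v r) : IsDiamondWalk e α u v r := by
  induction h with
  | zero => exact isDiamondWalk_top_bot hα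
  | top_bot => exact isDiamondWalk_top_bot hα
  | mids β =>
    have h := isDiamondWalk_top_bot (e := e) (lt_of_le_of_lt le_self_add hα : β < ω₁)
    -- Up from one midpoint to the top, then down to the other.
    have := (h.copy 0 true).symm.trans (h.copy 1 true)
    rwa [add_halves] at this
  | copy i s _ ih => exact (ih (lt_of_le_of_lt le_self_add hα)).copy i s
  | piece hl n _ ih => exact (ih ((e.seq_lt hα hl n).trans hα)).piece hl n

/-! ### Functions that are `1`-Lipschitz on edges -/

/-- `g` is `1`-Lipschitz on the edges of `D_α`. -/
def EdgeLipschitz (e : LimitEnumeration) (α : Ordinal.{0}) (g : DiamondVertex → ℝ) : Prop :=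
  ∀ ⦃u v : DiamondVertex⦄ ⦃w : ℝ⦄, IsDiamondEdge e α s(u, v) w → |g u - g v| ≤ w

theorem EdgeLipschitz.abs_sub_le {g : DiamondVertex → ℝ} (hg : EdgeLipschitz e α g)
    {u v : DiamondVertex} {ℓ : ℝ} (h : IsDiamondWalk e α u v ℓ) : |g u - g v| ≤ ℓ := by
  induction h with
  | nil => simp
  | cons huv _ ih => exact (_root_.abs_sub_le _ _ _).trans (add_le_add (hg huv) ih)

theorem edgeLipschitz_zero {g : DiamondVertex → ℝ} (h : |g top - g bot| ≤ 1) :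
    EdgeLipschitz e 0 g := by
  intro u v w he
  generalize h0 : (0 : Ordinal.{0}) = γ at he
  generalize hp : s(u, v) = p at he
  cases he with
  | zero =>
    rcases Sym2.eq_iff.1 hp with ⟨rfl, rfl⟩ | ⟨rfl, rfl⟩
    · exact h
    · rwa [abs_sub_comm]
  | copy => exact absurd h0.symm (add_one_ne_zero_ordinal _)
  | piece hl => exact absurd (h0 ▸ hl) not_isSuccLimit_zero

/-- The factor `2` undoes the halving of weights in the copies. -/
theorem edgeLipschitz_succ {g : DiamondVertex → ℝ}
    (h : ∀ i s, EdgeLipschitz e β (fun v => 2 * g (copyMap i s v))) :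
    EdgeLipschitz e (β + 1) g := by
  intro u v w he
  generalize h0 : β + 1 = γ at he
  generalize hp : s(u, v) = p at he
  cases he with
  | zero => exact absurd h0 (add_one_ne_zero_ordinal _)
  | @copy β' i s p w he =>
    obtain rfl := Order.add_one_inj.1 h0
    induction p with | _ u' v'
    have h1 := h i s he
    rw [← mul_sub, abs_mul, abs_two] at h1
    rw [Sym2.map_mk] at hp
    rcases Sym2.eq_iff.1 hp with ⟨rfl, rfl⟩ | ⟨rfl, rfl⟩
    · linarith
    · rw [abs_sub_comm]; linarith
  | piece hl => exact absurd (h0 ▸ hl) (not_isSuccLimit_add_one β)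

theorem edgeLipschitz_limit (hα : Order.IsSuccLimit α) {g : DiamondVertex → ℝ}
    (h : ∀ n, EdgeLipschitz e (e.seq α n) (fun v => g (pieceMap n v))) :
    EdgeLipschitz e α g := by
  intro u v w he
  generalize hp : s(u, v) = p at he
  cases he with
  | zero => exact absurd hα not_isSuccLimit_zero
  | copy => exact absurd hα (not_isSuccLimit_add_one _)
  | @piece _ _ n p w he =>
    induction p with | _ u' v'
    rw [Sym2.map_mk] at hp
    rcases Sym2.eq_iff.1 hp with ⟨rfl, rfl⟩ | ⟨rfl, rfl⟩
    · exact h n he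
    · rw [abs_sub_comm]; exact h n he

theorem EdgeLipschitz.affine {g : DiamondVertex → ℝ} (hg : EdgeLipschitz e α g) {a : ℝ}
    (ha : |a| ≤ 1) (c : ℝ) : EdgeLipschitz e α (fun v => c + a * g v) := by
  intro u v w h
  have : c + a * g u - (c + a * g v) = a * (g u - g v) := by ring
  rw [this, abs_mul]
  calc |a| * |g u - g v| ≤ 1 * w :=
        mul_le_mul ha (hg h) (abs_nonneg _) zero_le_one
    _ = w := one_mul w

/-- The function on `D_{β+1}` with given values on `D_1` and on the interiors of the copies. -/
def glueCopies {E : Type*} (a b : E) (m : Fin 2 → E) (g : Fin 2 → Bool → DiamondVertex → E) :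
    DiamondVertex → E
  | top => a
  | bot => b
  | .inner (.mid i) => m i
  | .inner (.copy i s v) => g i s (inner v)
  | .inner (.piece _ _) => a

/-- The function on `D_α`, for `α` limit, with given values at the top and the bottom and on the
interiors of the pieces. -/
def gluePieces {E : Type*} (a b : E) (g : ℕ → DiamondVertex → E) : DiamondVertex → E
  | top => a
  | bot => b
  | .inner (.piece n v) => g n (inner v)
  | .inner _ => a

/-- The hypotheses say that the four pieces agree at the shared vertices. -/
theorem glueCopies_copyMap {E : Type*} {a b : E} {m : Fin 2 → E}
    {g : Fin 2 → Bool → DiamondVertex → E} (h₁ : ∀ i, g i true top = a)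
    (h₂ : ∀ i, g i true bot = m i) (h₃ : ∀ i, g i false top = m i) (h₄ : ∀ i, g i false bot = b)
    (i : Fin 2) (s : Bool) (v : DiamondVertex) :
    glueCopies a b m g (copyMap i s v) = g i s v := by
  rcases s <;> rcases v <;> simp [glueCopies, copyMap, *]

theorem gluePieces_pieceMap {E : Type*} {a b : E} {g : ℕ → DiamondVertex → E}
    (h₁ : ∀ n, g n top = a) (h₂ : ∀ n, g n bot = b) (n : ℕ) (v : DiamondVertex) :
    gluePieces a b g (pieceMap n v) = g n v := by
  rcases v <;> simp [gluePieces, pieceMap, *]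

/-- The height above the bottom: half the height of the smaller diamond on each copy, raised by
`1/2` on the upper ones. The fixed end values make limits glue. -/
theorem exists_edgeLipschitz_height (hα : α < ω₁) :
    ∃ h, EdgeLipschitz e α h ∧ h top = 1 ∧ h bot = 0 := by
  refine countable_ordinal_induction e
    (P := fun α => ∃ h, EdgeLipschitz e α h ∧ h top = 1 ∧ h bot = 0) ?_ ?_ ?_ α hα
  · exact ⟨fun v => match v with
      | top => 1
      | _ => 0, edgeLipschitz_zero (by norm_num), rfl, rfl⟩
  · rintro β ⟨h, hL, ht, hb⟩
    refine ⟨glueCopies 1 0 (fun _ => 1 / 2)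
      (fun _ s v => (if s then 1 / 2 else 0) + 1 / 2 * h v), edgeLipschitz_succ fun i s => ?_,
      rfl, rfl⟩
    simp only [glueCopies_copyMap (a := (1 : ℝ)) (b := 0) (m := fun _ => 1 / 2)
      (g := fun _ s v => (if s then 1 / 2 else 0) + 1 / 2 * h v)
      (by intro i; norm_num [ht]) (by intro i; norm_num [hb]) (by intro i; norm_num [ht])
      (by intro i; norm_num [hb])]
    convert hL.affine (a := 1) (by simp) (2 * if s then 1 / 2 else 0) using 2
    ring
  · intro α _ hl ih
    choose h hL ht hb using ih
    refine ⟨gluePieces 1 0 h, edgeLipschitz_limit hl fun n => ?_, rfl, rfl⟩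
    simp only [gluePieces_pieceMap ht hb]
    exact hL n

/-- A dual witness that no walk is shorter than `r`. A witness on one copy or piece is extended to
the whole diamond without increasing slopes. -/
theorem ActiveScale.exists_edgeLipschitz (hα : α < ω₁) {u v : DiamondVertex} {r : ℝ}
    (h : ActiveScale e α u v r) : ∃ g, EdgeLipschitz e α g ∧ g u - g v = r := by
  induction h with
  | zero =>
    obtain ⟨h, hL, ht, hb⟩ := exists_edgeLipschitz_height (e := e) hα
    exact ⟨h, hL, by rw [ht, hb, sub_zero]⟩
  | top_bot =>
    obtain ⟨h, hL, ht, hb⟩ := exists_edgeLipschitz_height (e := e) hα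
    exact ⟨h, hL, by rw [ht, hb, sub_zero]⟩
  | mids β =>
    obtain ⟨h, hL, ht, hb⟩ :=
      exists_edgeLipschitz_height (e := e) (lt_of_le_of_lt le_self_add hα : β < ω₁)
    -- The witness is `1` and `0` at the midpoints and `1/2` at top and bottom; on each copy it is
    -- an offset `c` plus half the height with sign `a`.
    let c : Fin 2 → Bool → ℝ := fun i s => if i = 0 then (if s then 1 else 1 / 2)
      else (if s then 0 else 1 / 2)
    let a : Fin 2 → Bool → ℝ := fun i s => if i = 0 then (if s then - 1 else 1)
      else (if s then 1 else - 1)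
    let g : Fin 2 → Bool → DiamondVertex → ℝ := fun i s v => c i s + 1 / 2 * (a i s * h v)
    refine ⟨glueCopies (1 / 2) (1 / 2) (fun i => if i = 0 then 1 else 0) g,
      edgeLipschitz_succ fun i s => ?_, by simp [glueCopies]⟩
    have hg := glueCopies_copyMap (a := (1 / 2 : ℝ)) (b := 1 / 2)
      (m := fun i => if i = 0 then 1 else 0) (g := g)
      (by intro i; fin_cases i <;> norm_num [g, c, a, ht])
      (by intro i; fin_cases i <;> norm_num [g, c, a, hb])
      (by intro i; fin_cases i <;> norm_num [g, c, a, ht])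
      (by intro i; fin_cases i <;> norm_num [g, c, a, hb])
    simp only [hg]
    convert hL.affine (a := a i s) (by simp only [a]; split_ifs <;> simp) (2 * c i s) using 2
    simp only [g]
    ring
  | @copy β i s u v r h ih =>
    obtain ⟨g, hL, hr⟩ := ih (lt_of_le_of_lt le_self_add hα)
    -- the copies on the other level are collapsed to a point
    let k : Bool → ℝ := fun s' => if s' = s then 1 else 0
    let c : Bool → ℝ := fun s' => if s' = s then 0 else if s then g bot else g top
    obtain ⟨G, hG⟩ : ∃ G : DiamondVertex → ℝ, ∀ j s' v,
        G (copyMap j s' v) = (c s' + k s' * g v) / 2 :=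
      ⟨_, glueCopies_copyMap (a := g top / 2) (b := g bot / 2)
        (m := fun _ => if s then g bot / 2 else g top / 2)
        (g := fun _ s' v => (c s' + k s' * g v) / 2)
        (by rcases s <;> simp [k, c]) (by rcases s <;> simp [k, c])
        (by rcases s <;> simp [k, c]) (by rcases s <;> simp [k, c])⟩
    refine ⟨G, edgeLipschitz_succ fun j s' => ?_, ?_⟩
    · simp only [hG]
      convert hL.affine (a := k s') (by simp only [k]; split_ifs <;> simp) (c s') using 2
      ring
    · rw [hG, hG]
      simp only [k, c, if_true]
      linarith
  | @piece α hl n u v r h ih =>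
    obtain ⟨g, hL, hr⟩ := ih ((e.seq_lt hα hl n).trans hα)
    have hlt := fun m => (e.seq_lt hα hl m).trans hα
    choose k hk ht hb using fun m => exists_edgeLipschitz_height (e := e) (hlt m)
    -- The other pieces interpolate along their height between the end values of `g`. The slope is
    -- at most `1` because a walk of length `1` joins top and bottom in the `n`-th piece.
    let G : ℕ → DiamondVertex → ℝ := fun m v =>
      if m = n then g v else g bot + (g top - g bot) * k m v
    have hG := gluePieces_pieceMap (a := g top) (b := g bot) (g := G)
      (by intro m; simp only [G]; split_ifs <;> simp [ht])
      (by intro m; simp only [G]; split_ifs <;> simp [hb])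
    refine ⟨gluePieces (g top) (g bot) G, edgeLipschitz_limit hl fun m => ?_, ?_⟩
    · simp only [hG]
      by_cases hm : m = n
      · subst hm
        simpa [G] using hL
      · simp only [G, if_neg hm]
        exact (hk m).affine (hL.abs_sub_le (isDiamondWalk_top_bot (hlt n))) _
    · rw [hG, hG]
      simpa [G] using hr

theorem ActiveScale.diamondDist_eq (hα : α < ω₁) {u v : diamond e α} {r : ℝ}
    (h : ActiveScale e α u v r) : diamondDist e α u v = r := by
  have hw := h.isDiamondWalk hα
  obtain ⟨g, hL, hr⟩ := h.exists_edgeLipschitz hα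
  have hlow : ∀ ℓ ∈ {ℓ : ℝ | IsDiamondWalk e α u v ℓ}, r ≤ ℓ := fun ℓ hℓ =>
    hr ▸ (le_abs_self _).trans (hL.abs_sub_le hℓ)
  exact le_antisymm (csInf_le ⟨r, hlow⟩ hw) (le_csInf ⟨r, hw⟩ hlow)

theorem diamondDist_comm (u v : diamond e α) : diamondDist e α u v = diamondDist e α v u := by
  unfold diamondDist
  congr 1
  ext ℓ
  exact ⟨IsDiamondWalk.symm, IsDiamondWalk.symm⟩

/-- `f` satisfies the bounds of a sub-Lipschitz embedding of `D_α`, for active pairs whose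
distance is known. -/
def IsSubLipschitz {X : Type*} [NormedAddCommGroup X] (e : LimitEnumeration) (α : Ordinal.{0})
    (A B : ℝ) (f : DiamondVertex → X) : Prop :=
  ∀ ⦃u v : DiamondVertex⦄ ⦃r : ℝ⦄, ActiveScale e α u v r →
    A * r ≤ ‖f u - f v‖ ∧ ‖f u - f v‖ ≤ B * r

-- The path metric disappears: on active pairs it is the explicit scale.
open Classical in
theorem diamondSubLipschitzEmbeds_iff {X : Type*} [NormedAddCommGroup X] (hα : α < ω₁) :
    DiamondSubLipschitzEmbeds e α X ↔
      ∃ A B : ℝ, 0 < A ∧ 0 < B ∧ ∃ f : DiamondVertex → X, IsSubLipschitz e α A B f := by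
  constructor
  · rintro ⟨A, B, f, hA, hB, hf⟩
    refine ⟨A, B, hA, hB, fun v => if h : v ∈ diamond e α then f ⟨v, h⟩ else 0, ?_⟩
    intro u v r h
    obtain ⟨hu, hv⟩ := h.mem_diamond hα
    have hu : u ∈ diamond e α := hu
    have hv : v ∈ diamond e α := hv
    simp only [dif_pos hu, dif_pos hv]
    have := hf ⟨u, hu⟩ ⟨v, hv⟩ h.isActivePair
    rwa [ActiveScale.diamondDist_eq hα (u := ⟨u, hu⟩) (v := ⟨v, hv⟩) h] at this
  · rintro ⟨A, B, hA, hB, f, hf⟩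
    refine ⟨A, B, fun v => f v, hA, hB, fun u v huv => ?_⟩
    obtain ⟨u', v', r, hp, h⟩ := huv.exists_activeScale hα
    rcases Sym2.eq_iff.1 hp with ⟨rfl, rfl⟩ | ⟨rfl, rfl⟩
    · rw [h.diamondDist_eq hα]
      exact hf h
    · rw [diamondDist_comm, h.diamondDist_eq hα, norm_sub_rev]
      exact hf h

end Diamond

/-! ### Trees and diamonds -/

section TreeDiamond

open DiamondVertex

variable {e : LimitEnumeration} {X : Type*} [NormedAddCommGroup X] {α β : Ordinal.{0}}
  {A B : ℝ}

theorem isSubLipschitz_zero {f : DiamondVertex → X} (h₁ : A ≤ ‖f top - f bot‖)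
    (h₂ : ‖f top - f bot‖ ≤ B) : IsSubLipschitz e 0 A B f := by
  intro u v r h
  generalize h0 : (0 : Ordinal.{0}) = γ at h
  cases h with
  | zero => simpa using And.intro h₁ h₂
  | top_bot => exact absurd h0.symm (add_one_ne_zero_ordinal _)
  | mids => exact absurd h0.symm (add_one_ne_zero_ordinal _)
  | copy => exact absurd h0.symm (add_one_ne_zero_ordinal _)
  | piece hl => exact absurd (h0 ▸ hl) not_isSuccLimit_zero

theorem isSubLipschitz_succ {f : DiamondVertex → X} (h₁ : A ≤ ‖f top - f bot‖)
    (h₂ : ‖f top - f bot‖ ≤ B) (h₃ : A ≤ ‖f (inner (.mid 0)) - f (inner (.mid 1))‖)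
    (h₄ : ‖f (inner (.mid 0)) - f (inner (.mid 1))‖ ≤ B)
    (h : ∀ i s, IsSubLipschitz e β (A / 2) (B / 2) (fun v => f (copyMap i s v))) :
    IsSubLipschitz e (β + 1) A B f := by
  intro u v r hr
  generalize h0 : β + 1 = γ at hr
  cases hr with
  | zero => exact absurd h0 (add_one_ne_zero_ordinal _)
  | top_bot => simpa using And.intro h₁ h₂
  | mids => simpa using And.intro h₃ h₄
  | @copy β' i s u v r hr =>
    obtain rfl := Order.add_one_inj.1 h0
    have := h i s hr
    rwa [div_mul_eq_mul_div, div_mul_eq_mul_div, ← mul_div_assoc, ← mul_div_assoc] at *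
  | piece hl => exact absurd (h0 ▸ hl) (not_isSuccLimit_add_one β)

theorem isSubLipschitz_limit (hα : Order.IsSuccLimit α) {f : DiamondVertex → X}
    (h : ∀ n, IsSubLipschitz e (e.seq α n) A B (fun v => f (pieceMap n v))) :
    IsSubLipschitz e α A B f := by
  intro u v r hr
  cases hr with
  | zero => exact absurd hα not_isSuccLimit_zero
  | top_bot => exact absurd hα (not_isSuccLimit_add_one _)
  | mids => exact absurd hα (not_isSuccLimit_add_one _)
  | copy => exact absurd hα (not_isSuccLimit_add_one _)
  | piece _ n hr => exact h n hr

variable [NormedSpace ℝ X]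

theorem IsSubLipschitz.affine {f : DiamondVertex → X} (h : IsSubLipschitz e α A B f) {c : ℝ}
    (hc : 0 ≤ c) (z : X) : IsSubLipschitz e α (c * A) (c * B) (fun v => z + c • f v) := by
  intro u v r hr
  obtain ⟨h₁, h₂⟩ := h hr
  rw [add_sub_add_left_eq_sub, ← smul_sub, norm_smul, Real.norm_of_nonneg hc, mul_assoc, mul_assoc]
  exact ⟨by gcongr, by gcongr⟩

/-- A tree whose values have norms between `A` and `B` gives a map of the diamond. -/
theorem HasTree.exists_isSubLipschitz {C : Set X} {δ : ℝ} (hA : A ≤ δ)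
    (hC : ∀ y ∈ C, A ≤ ‖y‖ ∧ ‖y‖ ≤ B) {x : X} (h : HasTree e C δ α x) :
    ∃ f : DiamondVertex → X, f top = x ∧ f bot = 0 ∧ IsSubLipschitz e α A B f := by
  induction h with
  | @zero x hx =>
    refine ⟨fun v => match v with
      | top => x
      | _ => 0, rfl, rfl, isSubLipschitz_zero ?_ ?_⟩
    · simpa using (hC x hx).1
    · simpa using (hC x hx).2
  | @succ β x x₀ x₁ hx hm hd h₀ h₁ ih₀ ih₁ =>
    obtain ⟨f₀, ht₀, hb₀, hf₀⟩ := ih₀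
    obtain ⟨f₁, ht₁, hb₁, hf₁⟩ := ih₁
    let y : Fin 2 → X := fun i => if i = 0 then x₀ else x₁
    let k : Fin 2 → DiamondVertex → X := fun i => if i = 0 then f₀ else f₁
    have hkt : ∀ i, k i top = y i := by intro i; simp only [k, y]; split_ifs <;> assumption
    have hkb : ∀ i, k i bot = 0 := by intro i; simp only [k]; split_ifs <;> assumption
    have hk : ∀ i, IsSubLipschitz e β A B (k i) := by
      intro i; simp only [k]; split_ifs <;> assumption
    have hy : ∀ i, x = (1 / 2 : ℝ) • (y i + y (1 - i)) := by
      intro i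
      fin_cases i
      · simpa [y] using hm
      · simpa [y, add_comm] using hm
    -- The lower copy on side `i` has increment `y i / 2`. The upper one has `x - y i / 2 = y (1 -
    -- i) / 2`, so it carries the map of the other child, translated by `y i / 2`.
    let g : Fin 2 → Bool → DiamondVertex → X := fun i s v =>
      (if s then (1 / 2 : ℝ) • y i else 0) + (1 / 2 : ℝ) • (if s then k (1 - i) v else k i v)
    have hg := glueCopies_copyMap (a := x) (b := 0) (m := fun i => (1 / 2 : ℝ) • y i) (g := g)
      (by intro i; simp only [g, if_true, hkt]; rw [hy i]; module)
      (by intro i; simp [g, hkb]) (by intro i; simp [g, hkt]) (by intro i; simp [g, hkb])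
    have hmid : (1 / 2 : ℝ) • y 0 - (1 / 2 : ℝ) • y 1 = (1 / 2 : ℝ) • (x₀ - x₁) := by
      simp only [y, if_true, one_ne_zero, if_false]; module
    have hn : ‖(1 / 2 : ℝ) • (x₀ - x₁)‖ = 1 / 2 * ‖x₀ - x₁‖ := by rw [norm_smul]; norm_num
    refine ⟨glueCopies x 0 (fun i => (1 / 2 : ℝ) • y i) g, rfl, rfl,
      isSubLipschitz_succ ?_ ?_ ?_ ?_ fun i s => ?_⟩
    · simpa [glueCopies] using (hC x hx).1
    · simpa [glueCopies] using (hC x hx).2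
    · simp only [glueCopies, hmid, hn]
      exact hA.trans hd
    · simp only [glueCopies, hmid, hn]
      have := norm_sub_le x₀ x₁
      have := (hC _ h₀.mem).2
      have := (hC _ h₁.mem).2
      linarith
    · simp only [hg, div_eq_inv_mul A, div_eq_inv_mul B, ← one_div]
      rcases s
      · simpa [g] using (hk i).affine (c := 1 / 2) (by norm_num) 0
      · simpa [g] using (hk (1 - i)).affine (c := 1 / 2) (by norm_num) ((1 / 2 : ℝ) • y i)
  | @limit α x hl h ih =>
    choose f ht hb hf using ih
    refine ⟨gluePieces x 0 f, rfl, rfl, isSubLipschitz_limit hl fun n => ?_⟩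
    simp only [gluePieces_pieceMap ht hb]
    exact hf n

/-- One of two points at distance `a` is at distance at least `a / 2` from any given midpoint. -/
theorem le_norm_add_sub_two_smul (p q m₀ m₁ : X) :
    ‖m₀ - m₁‖ ≤ ‖p + q - (2 : ℝ) • m₀‖ ∨ ‖m₀ - m₁‖ ≤ ‖p + q - (2 : ℝ) • m₁‖ := by
  by_contra! h
  -- The two vectors differ by `2 (m₀ - m₁)`, so they cannot both be shorter than `m₀ - m₁`.
  have h1 : (2 : ℝ) • (m₀ - m₁) = (p + q - (2 : ℝ) • m₁) - (p + q - (2 : ℝ) • m₀) := by module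
  have h2 := norm_sub_le (p + q - (2 : ℝ) • m₁) (p + q - (2 : ℝ) • m₀)
  rw [← h1, norm_smul, Real.norm_ofNat] at h2
  linarith [h.1, h.2]

/-- A map of the diamond gives a tree. -/
theorem IsSubLipschitz.hasTree (hα : α < ω₁) {f : DiamondVertex → X}
    (h : IsSubLipschitz e α A B f) :
    HasTree e (Metric.closedBall (0 : X) B) A α (f top - f bot) := by
  have hmem : ∀ {α : Ordinal.{0}} {f : DiamondVertex → X}, α < ω₁ → IsSubLipschitz e α A B f →
      f top - f bot ∈ Metric.closedBall (0 : X) B := fun hα h => by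
    simpa using (h (activeScale_top_bot hα)).2
  -- The second bound belongs to the induction predicate, so that it is available in each case; the
  -- first is the argument of the induction principle.
  suffices H : ∀ α < ω₁, α < ω₁ → ∀ f : DiamondVertex → X, IsSubLipschitz e α A B f →
      HasTree e (Metric.closedBall (0 : X) B) A α (f top - f bot) from H α hα hα f h
  refine countable_ordinal_induction e ?_ ?_ ?_
  · exact fun hα f h => .zero (hmem hα h)
  · intro β ih hα f h
    have hmid := (h (.mids β)).1
    obtain ⟨i, hi⟩ : ∃ i, A ≤ ‖f top + f bot - (2 : ℝ) • f (inner (.mid i))‖ := by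
      rw [mul_one] at hmid
      rcases le_norm_add_sub_two_smul (f top) (f bot) (f (inner (.mid 0))) (f (inner (.mid 1)))
        with h' | h'
      · exact ⟨0, hmid.trans h'⟩
      · exact ⟨1, hmid.trans h'⟩
    -- Doubling compensates for the halved scale, so `A` and `B` do not deteriorate.
    have hcopy : ∀ s, IsSubLipschitz e β A B (fun v => (2 : ℝ) • f (copyMap i s v)) := by
      intro s u v r hr
      obtain ⟨h₁, h₂⟩ := h (hr.copy i s)
      rw [← smul_sub, norm_smul, Real.norm_ofNat]
      constructor <;> linarith
    have hβ : β < ω₁ := lt_of_le_of_lt le_self_add hα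
    refine .succ (hmem hα h) ?_ ?_ (ih hβ _ (hcopy true)) (ih hβ _ (hcopy false))
    · simp only [copyMap]; module
    · have : (2 : ℝ) • f top - (2 : ℝ) • f (inner (.mid i)) -
          ((2 : ℝ) • f (inner (.mid i)) - (2 : ℝ) • f bot) =
          (2 : ℝ) • (f top + f bot - (2 : ℝ) • f (inner (.mid i))) := by module
      simp only [copyMap, this, norm_smul, Real.norm_ofNat]
      linarith
  · intro α _ hl ih hα f h
    exact .limit hl fun n => ih n ((e.seq_lt hα hl n).trans hα) (fun v => f (pieceMap n v))
      fun u v r hr => h (hr.piece hl n)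

/-- Height `0` is excluded because the zero space contains a tree of height `0` but no two distinct
points. A positive height forces `X` to be nontrivial, which provides the translation vector. -/
theorem lt_dyadicTreeIndex_iff_diamondSubLipschitzEmbeds (hα₀ : α ≠ 0) (hα : α < ω₁) :
    (α : WithTop Ordinal.{0}) < dyadicTreeIndex e X ↔ DiamondSubLipschitzEmbeds e α X := by
  rw [lt_dyadicTreeIndex_iff hα, diamondSubLipschitzEmbeds_iff hα]
  constructor
  · rintro ⟨δ, hδ, x, hx⟩
    have := hx.nontrivial hδ hα₀ hα
    obtain ⟨z, hz⟩ := exists_norm_eq X zero_le_two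
    have hx' := hx.map (C' := {y | 1 ≤ ‖y‖ ∧ ‖y‖ ≤ 3}) zero_le_one z fun y hy => by
      have h1 := norm_add_le y z
      have h2 := norm_sub_le (y + z) y
      have h3 : ‖y‖ ≤ 1 := by simpa using hy
      rw [add_sub_cancel_left] at h2
      rw [one_smul]
      constructor <;> linarith
    rw [one_mul] at hx'
    obtain ⟨f, -, -, hf⟩ := hx'.exists_isSubLipschitz (A := min 1 δ) (B := 3) (min_le_right _ _)
      fun y hy => ⟨(min_le_left _ _).trans hy.1, hy.2⟩
    exact ⟨_, _, lt_min one_pos hδ, three_pos, f, hf⟩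
  · rintro ⟨A, B, hA, hB, f, hf⟩
    refine ⟨B⁻¹ * A, by positivity, _, (hf.hasTree hα).map (inv_nonneg.2 hB.le) 0 fun y hy => ?_⟩
    have hy' : ‖y‖ ≤ B := by simpa using hy
    rw [add_zero, mem_closedBall_zero_iff, norm_smul, norm_inv, Real.norm_of_nonneg hB.le,
      inv_mul_le_iff₀ hB, mul_one]
    exact hy'

end TreeDiamond

/-! ### Bi-Lipschitz embeddings -/

section BiLipschitz

variable {e : LimitEnumeration} {X Y : Type*} [NormedAddCommGroup X] [NormedAddCommGroup Y]
  {α : Ordinal.{0}}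

theorem BiLipschitzEmbeds.exists_bounds (h : BiLipschitzEmbeds Y X) :
    ∃ (φ : Y → X) (A B : ℝ), 0 < A ∧ 0 < B ∧
      ∀ u v, A * ‖u - v‖ ≤ ‖φ u - φ v‖ ∧ ‖φ u - φ v‖ ≤ B * ‖u - v‖ := by
  obtain ⟨φ, ⟨K, hK⟩, ⟨L, hL⟩⟩ := h
  -- Adding `1` makes both constants positive, as `K` and `L` may vanish.
  refine ⟨φ, ((L : ℝ) + 1)⁻¹, K + 1, by positivity, by positivity, fun u v => ⟨?_, ?_⟩⟩
  · rw [inv_mul_le_iff₀ (by positivity)]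
    have := hL.le_mul_dist u v
    rw [dist_eq_norm, dist_eq_norm] at this
    linarith [norm_nonneg (φ u - φ v)]
  · have := hK.dist_le_mul u v
    rw [dist_eq_norm, dist_eq_norm] at this
    linarith [norm_nonneg (u - v)]

theorem DiamondSubLipschitzEmbeds.comp (hYX : BiLipschitzEmbeds Y X)
    (h : DiamondSubLipschitzEmbeds e α Y) : DiamondSubLipschitzEmbeds e α X := by
  obtain ⟨φ, A', B', hA', hB', hφ⟩ := hYX.exists_bounds
  obtain ⟨A, B, f, hA, hB, hf⟩ := h
  refine ⟨A' * A, B' * B, φ ∘ f, mul_pos hA' hA, mul_pos hB' hB, fun u v huv => ⟨?_, ?_⟩⟩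
  · rw [mul_assoc]
    exact (mul_le_mul_of_nonneg_left (hf u v huv).1 hA'.le).trans (hφ _ _).1
  · rw [mul_assoc]
    exact (hφ _ _).2.trans (mul_le_mul_of_nonneg_left (hf u v huv).2 hB'.le)

variable [NormedSpace ℝ X] [NormedSpace ℝ Y]

/-- If the index `a` of `X` were smaller, it would be a countable nonzero ordinal; then `D_a` would
embed into `Y`, hence into `X`, giving `a < a`. -/
theorem dyadicTreeIndex_le_of_biLipschitzEmbeds (hYX : BiLipschitzEmbeds Y X) :
    dyadicTreeIndex e Y ≤ dyadicTreeIndex e X := by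
  by_contra! hlt
  obtain ⟨γ, hγ, hle⟩ := exists_dyadicTreeIndex_le hlt.ne_top
  obtain ⟨a, ha⟩ := WithTop.ne_top_iff_exists.1 hlt.ne_top
  rw [← ha] at hle hlt
  have haω : a < ω₁ := lt_of_le_of_lt (WithTop.coe_le_coe.1 hle) hγ
  have ha0 : a ≠ 0 := by
    rintro rfl
    exact absurd (dyadicTreeIndex_pos (e := e) (X := X)) (by rw [← ha]; exact lt_irrefl _)
  rw [lt_dyadicTreeIndex_iff_diamondSubLipschitzEmbeds ha0 haω] at hlt
  have := (lt_dyadicTreeIndex_iff_diamondSubLipschitzEmbeds ha0 haω).2 (hlt.comp hYX)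
  rw [← ha] at this
  exact lt_irrefl _ this

/-- The Infinite Tree Property passes to bi-Lipschitz images: an edge `(p, q)` of the infinite
diamond spanned by the tree is subdivided at the better one of its two midpoints. -/
theorem InfiniteTreeProperty.of_biLipschitzEmbeds (hYX : BiLipschitzEmbeds Y X)
    (h : InfiniteTreeProperty Y) : InfiniteTreeProperty X := by
  obtain ⟨φ, A, B, hA, hB, hφ⟩ := hYX.exists_bounds
  obtain ⟨δ, hδ, y, hy, hy'⟩ := h
  -- A state is an edge `(p, q)` whose increment is the tree value at `s` scaled by `2^(-|s|)`;
  -- `val` is the rescaled increment of its image.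
  let S := {t : List (Fin 2) × Y × Y // t.2.2 - t.2.1 = ((2 : ℝ) ^ t.1.length)⁻¹ • y t.1}
  let val : S → X := fun t => (2 : ℝ) ^ t.1.1.length • (φ t.1.2.2 - φ t.1.2.1)
  have step : ∀ t : S, ∃ t₀ t₁ : S,
      val t = (1 / 2 : ℝ) • (val t₀ + val t₁) ∧ A * δ ≤ 1 / 2 * ‖val t₀ - val t₁‖ := by
    rintro ⟨⟨s, p, q⟩, hpq⟩
    dsimp only at hpq
    set N : ℝ := (2 : ℝ) ^ s.length with hN
    have hN0 : 0 < N := by positivity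
    have hlen : ∀ i : Fin 2, (2 : ℝ) ^ (s ++ [i]).length = N * 2 := by
      intro i; rw [List.length_append, pow_add, List.length_singleton, pow_one]
    -- Going from `p` to `q`, the two children may be traversed in either order; this gives two
    -- candidate midpoints.
    let m : Fin 2 → Y := fun i => p + (N * 2)⁻¹ • y (s ++ [i])
    have hq : ∀ i, q - m i = (N * 2)⁻¹ • y (s ++ [1 - i]) := by
      intro i
      have hs : y s = (1 / 2 : ℝ) • (y (s ++ [i]) + y (s ++ [1 - i])) := by
        rw [(hy' s).1]
        fin_cases i
        · simp
        · simp [add_comm]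
      have hq : q = p + N⁻¹ • y s := by rw [← hpq]; abel
      rw [hq, hs, mul_inv]
      simp only [m, mul_inv]
      module
    obtain ⟨i, hi⟩ : ∃ i, A * ‖m 0 - m 1‖ ≤ ‖φ p + φ q - (2 : ℝ) • φ (m i)‖ := by
      have := (hφ (m 0) (m 1)).1
      rcases le_norm_add_sub_two_smul (φ p) (φ q) (φ (m 0)) (φ (m 1)) with h' | h'
      · exact ⟨0, this.trans h'⟩
      · exact ⟨1, this.trans h'⟩
    have hm : δ ≤ N * ‖m 0 - m 1‖ := by
      have : m 0 - m 1 = (N * 2)⁻¹ • (y (s ++ [0]) - y (s ++ [1])) := by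
        simp only [m]; module
      rw [this, norm_smul, Real.norm_of_nonneg (by positivity), mul_inv, ← mul_assoc, ← mul_assoc,
        mul_inv_cancel₀ hN0.ne', one_mul, ← one_div]
      exact (hy' s).2
    refine ⟨⟨(s ++ [1 - i], m i, q), by rw [hlen]; exact hq i⟩,
      ⟨(s ++ [i], p, m i), by rw [hlen]; simp only [m, add_sub_cancel_left]⟩,
      ?_, ?_⟩
    · simp only [val, hlen, ← hN]
      module
    · simp only [val, hlen]
      have : (N * 2) • (φ q - φ (m i)) - (N * 2) • (φ (m i) - φ p) =
          (N * 2) • (φ p + φ q - (2 : ℝ) • φ (m i)) := by module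
      rw [this, norm_smul, Real.norm_of_nonneg (by positivity)]
      nlinarith [mul_le_mul_of_nonneg_left hi hN0.le, mul_le_mul_of_nonneg_left hm hA.le]
  choose t₀ t₁ hmid hsep using step
  let next : S → Fin 2 → S := fun t i => if i = 0 then t₀ t else t₁ t
  have hbound : ∀ t : S, ‖val t‖ ≤ B := by
    rintro ⟨⟨s, p, q⟩, hpq⟩
    dsimp only at hpq
    have h1 := (hφ q p).2
    have h2 : ‖y s‖ ≤ 1 := by simpa using hy s
    rw [hpq, norm_smul, norm_inv, norm_pow, Real.norm_ofNat] at h1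
    simp only [val, norm_smul, norm_pow, Real.norm_ofNat]
    calc (2 : ℝ) ^ s.length * ‖φ q - φ p‖
        ≤ 2 ^ s.length * (B * ((2 ^ s.length)⁻¹ * ‖y s‖)) := by gcongr
      _ = B * ‖y s‖ := by field_simp
      _ ≤ B * 1 := by gcongr
      _ = B := mul_one B
  let root : S := ⟨([], 0, y []), by simp⟩
  -- The new tree follows the chosen subdivisions from the root edge. Its branches may be labelled
  -- differently from those of `y`, which is why states record their own node.
  refine ⟨B⁻¹ * (A * δ), by positivity, fun s => B⁻¹ • val (s.foldl next root), fun s => ?_,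
    fun s => ?_⟩
  · rw [mem_closedBall_zero_iff, norm_smul, norm_inv, Real.norm_of_nonneg hB.le,
      inv_mul_le_iff₀ hB, mul_one]
    exact hbound _
  · simp only [List.foldl_append, List.foldl_cons, List.foldl_nil]
    set t := s.foldl next root
    have e₀ : next t 0 = t₀ t := rfl
    have e₁ : next t 1 = t₁ t := rfl
    rw [e₀, e₁, ← smul_sub, norm_smul, norm_inv, Real.norm_of_nonneg hB.le, hmid t]
    refine ⟨by module, ?_⟩
    calc B⁻¹ * (A * δ) ≤ B⁻¹ * (1 / 2 * ‖val (t₀ t) - val (t₁ t)‖) :=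
          mul_le_mul_of_nonneg_left (hsep t) (inv_nonneg.2 hB.le)
      _ = _ := by ring

end BiLipschitz

theorem theoremA (X : Type*) [NormedAddCommGroup X] [NormedSpace ℝ X] [CompleteSpace X]
    [TopologicalSpace.SeparableSpace X]
    (Y : Type*) [NormedAddCommGroup Y] [NormedSpace ℝ Y] [CompleteSpace Y]
    (hYX : BiLipschitzEmbeds Y X)
    (e : LimitEnumeration) (α : Ordinal.{0}) (hα₀ : 0 < α) (hα₁ : α < ω₁) :
    ((α : WithTop Ordinal.{0}) < dyadicTreeIndex e X ↔ DiamondSubLipschitzEmbeds e α X) ∧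
    dyadicTreeIndex e Y ≤ dyadicTreeIndex e X ∧
    (¬ InfiniteTreeProperty X → ¬ InfiniteTreeProperty Y) :=
  ⟨lt_dyadicTreeIndex_iff_diamondSubLipschitzEmbeds hα₀.ne' hα₁,
    dyadicTreeIndex_le_of_biLipschitzEmbeds hYX,
    fun hX hY => hX (hY.of_biLipschitzEmbeds hYX)⟩
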